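/- Throughout, $D$ is an integral domain; an atom is an irreducible element, and $\sim$ denotes the associate relation. $D$ is *atomic* if every non-zero non-unit is a finite product of atoms. $D$ is a *half-factorial domain (HFD)* if it is atomic and, for all atoms $p_1,\dots,p_m,q_1,\dots,q_n\in D$, $p_1\cdots p_m=q_1\cdots q_n$ implies $m=n$. $D$ is an *irreducible divisor pair domain (IDPD)* if it is atomic and for every non-zero non-unit $z\in D$ and every pair $p,q$ of non-associate irreducible divisors of $z$ there are atoms $p',q'\in D$ such that $pp'\sim qq'\mid z$. For a Krull domain $D$, $\operatorname{Cl}(D)$ denotes the divisor class group (divisorial fractional ideals modulo principal ones), $\mathfrak a\equiv\mathfrak b$ means that the divisorial ideals $\mathfrak a,\mathfrak b$ represent the same class in $\operatorname{Cl}(D)$, and $\mathfrak p^{(2)}=\mathfrak p^2D_{\mathfrak p}\cap D$ is the second symbolic power of a prime ideal $\mathfrak p$. **Theorem.** Let $D$ be a Krull domain such that for every height-1 prime ideal $\mathfrak p$ of $D$, either $\mathfrak p^{(2)}\equiv D$ or there is a height-1 prime ideal $\mathfrak q$ of $D$ such that $\mathfrak p\cap\mathfrak q\equiv D$. If $D$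 is an HFD, then $D$ is an IDPD. -/

import Mathlib

open scoped nonZeroDivisors

/-! ## Factorization properties of integral domains -/

/-- An integral domain is atomic if every non-zero non-unit is a finite product of
irreducible elements (atoms). -/
def IsAtomicDomain (D : Type*) [CommRing D] [IsDomain D] : Prop :=
  ∀ z : D, z ≠ 0 → ¬ IsUnit z → ∃ s : Multiset D, (∀ p ∈ s, Irreducible p) ∧ s.prod = z

/-- A half-factorial domain (HFD): an atomic domain in which any two factorizations into atoms
of the same element have the same number of factors. -/
def IsHFD (D : Type*) [CommRing D] [IsDomain D] : Prop :=
  IsAtomicDomain D ∧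
    ∀ s t : Multiset D, (∀ p ∈ s, Irreducible p) → (∀ q ∈ t, Irreducible q) →
      s.prod = t.prod → Multiset.card s = Multiset.card t

/-- An irreducible divisor pair domain (IDPD): an atomic domain such that for every non-zero
non-unit `z` and all non-associate irreducible divisors `p`, `q` of `z` there are atoms
`p'`, `q'` with `p * p'` associate to `q * q'` and dividing `z`. -/
def IsIDPD (D : Type*) [CommRing D] [IsDomain D] : Prop :=
  IsAtomicDomain D ∧
    ∀ z : D, z ≠ 0 → ¬ IsUnit z →
      ∀ p q : D, Irreducible p → Irreducible q → p ∣ z → q ∣ z → ¬ Associated p q →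
        ∃ p' q' : D, Irreducible p' ∧ Irreducible q' ∧
          Associated (p * p') (q * q') ∧ q * q' ∣ z

/-! ## Krull domains -/

/-- A Krull domain: the localization at each height-one prime is a discrete valuation ring,
the domain is the intersection of these localizations inside its fraction field, and each
non-zero element lies in only finitely many height-one primes. -/
class IsKrullDomain (D : Type*) [CommRing D] [IsDomain D] : Prop where
  isDiscreteValuationRing : ∀ (p : Ideal D) [p.IsPrime], p.height = 1 →
    IsDiscreteValuationRing (Localization.AtPrime p)
  mem_of_forall_height_one : ∀ x : FractionRing D,
    (∀ p : Ideal D, p.IsPrime → p.height = 1 → ∃ a s : D, s ∉ p ∧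
      x = algebraMap D (FractionRing D) a / algebraMap D (FractionRing D) s) →
    ∃ a : D, x = algebraMap D (FractionRing D) a
  finite_height_one : ∀ a : D, a ≠ 0 →
    {p : Ideal D | p.IsPrime ∧ p.height = 1 ∧ a ∈ p}.Finite

/-- The `n`-th symbolic power `p^(n)` of a prime ideal `p`: the contraction to `D` of the ideal
`p^n D_p` of the localization `D_p`. -/
noncomputable def symbolicPower {D : Type*} [CommRing D] (p : Ideal D) [p.IsPrime] (n : ℕ) :
    Ideal D :=
  ((p ^ n).map (algebraMap D (Localization.AtPrime p))).comap
    (algebraMap D (Localization.AtPrime p))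

/-- A Krull domain is completely integrally closed. -/
theorem IsKrullDomain.mem_of_isAlmostIntegral {D : Type*} [CommRing D] [IsDomain D]
    [IsKrullDomain D] {x : FractionRing D} (hx : IsAlmostIntegral D x) :
    ∃ a : D, x = algebraMap D (FractionRing D) a := by
  obtain ⟨r, hr, h⟩ := hx
  have hr0 : r ≠ 0 := nonZeroDivisors.ne_zero hr
  refine IsKrullDomain.mem_of_forall_height_one x fun p hp hp1 => ?_
  have := IsKrullDomain.isDiscreteValuationRing p hp1
  have hinj : Function.Injective (algebraMap D (Localization.AtPrime p)) :=
    IsLocalization.injective _ p.primeCompl_le_nonZeroDivisors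
  obtain ⟨a, b, hb, rfl⟩ := IsFractionRing.div_surjective (A := D) x
  have hb0 : b ≠ 0 := nonZeroDivisors.ne_zero hb
  have hb1 : algebraMap D (FractionRing D) b ≠ 0 := by simpa using hb0
  have key : ∀ n : ℕ, b ^ n ∣ r * a ^ n := by
    intro n
    obtain ⟨d, hd⟩ := h n
    refine ⟨d, ?_⟩
    apply IsFractionRing.injective D (FractionRing D)
    rw [Algebra.smul_def, div_pow] at hd
    have hbn : algebraMap D (FractionRing D) b ^ n ≠ 0 := pow_ne_zero _ hb1
    simp only [map_mul, map_pow]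
    rw [hd]
    field_simp
  have hdvd : algebraMap D (Localization.AtPrime p) b ∣ algebraMap D (Localization.AtPrime p) a := by
    by_cases ha0 : a = 0
    · simp [ha0]
    rw [← IsDiscreteValuationRing.addVal_le_iff_dvd]
    have hfin : ∀ c : D, c ≠ 0 → ∃ m : ℕ, IsDiscreteValuationRing.addVal
        (Localization.AtPrime p) (algebraMap D _ c) = m := by
      intro c hc
      have : IsDiscreteValuationRing.addVal
        (Localization.AtPrime p) (algebraMap D _ c) ≠ ⊤ := by
        rw [Ne, IsDiscreteValuationRing.addVal_eq_top_iff]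
        exact fun h0 => hc (hinj (by simpa using h0))
      exact ⟨_, (ENat.natCast_toNat this).symm⟩
    obtain ⟨va, hva⟩ := hfin a ha0
    obtain ⟨vb, hvb⟩ := hfin b hb0
    obtain ⟨vr, hvr⟩ := hfin r hr0
    have hv := IsDiscreteValuationRing.addVal_le_iff_dvd.mpr
      (map_dvd (algebraMap D (Localization.AtPrime p)) (key (vr + 1)))
    simp only [map_mul, map_pow, IsDiscreteValuationRing.addVal_mul,
      IsDiscreteValuationRing.addVal_pow, hva, hvb, hvr] at hv
    rw [hva, hvb]
    have hv' : (vr + 1) * vb ≤ vr + (vr + 1) * va := by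
      simp only [nsmul_eq_mul] at hv
      exact_mod_cast hv
    have : vb ≤ va := by
      by_contra! hlt
      nlinarith
    exact_mod_cast this
  obtain ⟨t, ht⟩ := hdvd
  obtain ⟨u, s, rfl⟩ := IsLocalization.exists_mk'_eq p.primeCompl t
  refine ⟨u, s, s.2, ?_⟩
  have hs0 : (s : D) ≠ 0 := fun h0 => s.2 (h0 ▸ p.zero_mem)
  have hs1 : algebraMap D (FractionRing D) s ≠ 0 := by simpa using hs0
  have e : a * s = b * u := by
    apply hinj
    rw [map_mul, ht, mul_assoc, IsLocalization.mk'_spec, ← map_mul]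
  rw [div_eq_div_iff hb1 hs1, ← map_mul, e, map_mul, mul_comm]

/-! ## Divisorial ideals and the divisor class group

For a fractional ideal `I` of `D`, the fractional ideal `1 / I` is `(D : I)`. -/

section Divisorial

variable {D : Type*} [CommRing D] [IsDomain D]

/-- A divisorial (fractional) ideal: a non-zero fractional ideal `I` with `(D : (D : I)) = I`. -/
def IsDivisorial (I : FractionalIdeal D⁰ (FractionRing D)) : Prop :=
  I ≠ 0 ∧ 1 / (1 / I) = I

theorem fracIdeal_one_div_ne_zero {I : FractionalIdeal D⁰ (FractionRing D)} (hI : I ≠ 0) :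
    1 / I ≠ 0 := by
  obtain ⟨d, hd, h⟩ := I.isFractional
  intro h0
  have : algebraMap D (FractionRing D) d ∈ 1 / I := by
    rw [FractionalIdeal.mem_div_iff_of_ne_zero hI]
    intro y hy
    rw [FractionalIdeal.mem_one_iff]
    obtain ⟨c, hc⟩ := h y hy
    exact ⟨c, by rw [hc, Algebra.smul_def]⟩
  rw [h0, FractionalIdeal.mem_zero_iff] at this
  exact nonZeroDivisors.ne_zero hd (by simpa using this)

theorem fracIdeal_mul_ne_zero {I J : FractionalIdeal D⁰ (FractionRing D)} (hI : I ≠ 0)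
    (hJ : J ≠ 0) : I * J ≠ 0 := by
  obtain ⟨x, hx, hx0⟩ : ∃ x ∈ I, x ≠ 0 := by
    by_contra! h
    exact hI (FractionalIdeal.eq_zero_iff.mpr h)
  obtain ⟨y, hy, hy0⟩ : ∃ y ∈ J, y ≠ 0 := by
    by_contra! h
    exact hJ (FractionalIdeal.eq_zero_iff.mpr h)
  exact fun h => mul_ne_zero hx0 hy0
    (FractionalIdeal.eq_zero_iff.mp h _ (FractionalIdeal.mul_mem_mul hx hy))

theorem fracIdeal_div_mul {I J : FractionalIdeal D⁰ (FractionRing D)} (hI : I ≠ 0) (hJ : J ≠ 0)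
    (A : FractionalIdeal D⁰ (FractionRing D)) : A / (I * J) = A / I / J := by
  refine eq_of_forall_le_iff fun C => ?_
  rw [FractionalIdeal.le_div_iff_mul_le (fracIdeal_mul_ne_zero hI hJ),
    FractionalIdeal.le_div_iff_mul_le hJ, FractionalIdeal.le_div_iff_mul_le hI,
    mul_assoc, mul_comm J I]

theorem fracIdeal_one_div_anti {I J : FractionalIdeal D⁰ (FractionRing D)} (hI : I ≠ 0)
    (h : I ≤ J) : 1 / J ≤ 1 / I := by
  have hJ : J ≠ 0 := fun h0 => hI (le_antisymm (h0 ▸ h) (FractionalIdeal.zero_le I))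
  rw [FractionalIdeal.le_div_iff_mul_le hI]
  exact (mul_le_mul_right h _).trans ((FractionalIdeal.le_div_iff_mul_le hJ).mp le_rfl)

theorem fracIdeal_le_bidual {I : FractionalIdeal D⁰ (FractionRing D)} (hI : I ≠ 0) :
    I ≤ 1 / (1 / I) := by
  refine (FractionalIdeal.le_div_iff_mul_le (fracIdeal_one_div_ne_zero hI)).mpr ?_
  exact FractionalIdeal.mul_one_div_le_one

theorem fracIdeal_tridual {I : FractionalIdeal D⁰ (FractionRing D)} (hI : I ≠ 0) :
    1 / (1 / (1 / I)) = 1 / I :=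
  le_antisymm (fracIdeal_one_div_anti hI (fracIdeal_le_bidual hI))
    (fracIdeal_le_bidual (fracIdeal_one_div_ne_zero hI))

theorem isDivisorial_one_div {I : FractionalIdeal D⁰ (FractionRing D)} (hI : I ≠ 0) :
    IsDivisorial (1 / I) :=
  ⟨fracIdeal_one_div_ne_zero hI, fracIdeal_tridual hI⟩

theorem fracIdeal_one_div_bidual_mul {I J : FractionalIdeal D⁰ (FractionRing D)} (hI : I ≠ 0)
    (hJ : J ≠ 0) : 1 / (1 / (1 / I) * J) = 1 / (I * J) := by
  rw [fracIdeal_div_mul (fracIdeal_one_div_ne_zero (fracIdeal_one_div_ne_zero hI)) hJ,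
    fracIdeal_tridual hI, fracIdeal_div_mul hI hJ]

theorem isDivisorial_spanSingleton {x : FractionRing D} (hx : x ≠ 0) :
    IsDivisorial (FractionalIdeal.spanSingleton D⁰ x) :=
  ⟨FractionalIdeal.spanSingleton_ne_zero_iff.mpr hx, by
    rw [FractionalIdeal.one_div_spanSingleton, FractionalIdeal.one_div_spanSingleton, inv_inv]⟩

theorem IsKrullDomain.one_div_mul_one_div [IsKrullDomain D]
    {I : FractionalIdeal D⁰ (FractionRing D)} (hI : I ≠ 0) : 1 / (I * (1 / I)) = 1 := by
  have hI' := fracIdeal_one_div_ne_zero hI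
  refine le_antisymm (fun x hx => ?_) ?_
  · have hx' : FractionalIdeal.spanSingleton D⁰ x * (1 / I) ≤ 1 / I := by
      rw [FractionalIdeal.le_div_iff_mul_le hI, mul_assoc, mul_comm (1 / I) I,
        ← FractionalIdeal.le_div_iff_mul_le (fracIdeal_mul_ne_zero hI hI'),
        FractionalIdeal.spanSingleton_le_iff_mem]
      exact hx
    obtain ⟨j, hj, hj0⟩ : ∃ j ∈ 1 / I, j ≠ 0 := by
      by_contra! h
      exact hI' (FractionalIdeal.eq_zero_iff.mpr h)
    have hpow : ∀ n : ℕ, x ^ n * j ∈ 1 / I := by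
      intro n
      induction n with
      | zero => simpa using hj
      | succ n ih =>
        rw [pow_succ', mul_assoc]
        exact hx' (FractionalIdeal.mul_mem_mul (FractionalIdeal.mem_spanSingleton_self _ x) ih)
    obtain ⟨r, hr, h⟩ := (1 / I).isFractional
    obtain ⟨u, w, hw, rfl⟩ := IsFractionRing.div_surjective (A := D) j
    have hw1 : algebraMap D (FractionRing D) w ≠ 0 := by
      simpa using nonZeroDivisors.ne_zero hw
    have hu0 : u ≠ 0 := by
      rintro rfl
      simp at hj0
    have hx2 : IsAlmostIntegral D x := by
      refine ⟨r * u, mul_mem hr (mem_nonZeroDivisors_of_ne_zero hu0), fun n => ?_⟩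
      obtain ⟨d, hd⟩ := h _ (hpow n)
      refine ⟨w * d, ?_⟩
      rw [map_mul, hd, Algebra.smul_def, Algebra.smul_def, map_mul]
      field_simp
    obtain ⟨a, ha⟩ := IsKrullDomain.mem_of_isAlmostIntegral hx2
    exact (FractionalIdeal.mem_one_iff _).mpr ⟨a, ha.symm⟩
  · rw [FractionalIdeal.le_div_iff_mul_le (fracIdeal_mul_ne_zero hI hI'), one_mul]
    exact FractionalIdeal.mul_one_div_le_one

end Divisorial

/-- The divisorial fractional ideals of `D`. -/
def DivisorialIdeal (D : Type*) [CommRing D] [IsDomain D] : Type _ :=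
  {I : FractionalIdeal D⁰ (FractionRing D) // IsDivisorial I}

namespace DivisorialIdeal

variable {D : Type*} [CommRing D] [IsDomain D]

/-- The principal fractional ideal `xD`, for a non-zero `x` in the fraction field. -/
noncomputable def principal (x : (FractionRing D)ˣ) : DivisorialIdeal D :=
  ⟨FractionalIdeal.spanSingleton D⁰ (x : FractionRing D), isDivisorial_spanSingleton x.ne_zero⟩

/-- The divisorial fractional ideals of a Krull domain form an abelian group: the product of `I`
and `J` is the divisorial closure `(D : (D : I * J))`, and the inverse of `I` is `(D : I)`. -/
noncomputable instance [IsKrullDomain D] : CommGroup (DivisorialIdeal D) where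
  mul I J := ⟨1 / (1 / (I.1 * J.1)),
    isDivisorial_one_div (fracIdeal_one_div_ne_zero (fracIdeal_mul_ne_zero I.2.1 J.2.1))⟩
  one := principal 1
  inv I := ⟨1 / I.1, isDivisorial_one_div I.2.1⟩
  mul_assoc I J K := by
    apply Subtype.ext
    change 1 / (1 / (1 / (1 / (I.1 * J.1)) * K.1)) = 1 / (1 / (I.1 * (1 / (1 / (J.1 * K.1)))))
    rw [fracIdeal_one_div_bidual_mul (fracIdeal_mul_ne_zero I.2.1 J.2.1) K.2.1, mul_comm I.1 (1 / _),
      fracIdeal_one_div_bidual_mul (fracIdeal_mul_ne_zero J.2.1 K.2.1) I.2.1, mul_assoc, mul_comm I.1]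
  one_mul I := by
    apply Subtype.ext
    change 1 / (1 / (FractionalIdeal.spanSingleton D⁰ (1 : FractionRing D) * I.1)) = I.1
    rw [FractionalIdeal.spanSingleton_one, one_mul, I.2.2]
  mul_one I := by
    apply Subtype.ext
    change 1 / (1 / (I.1 * FractionalIdeal.spanSingleton D⁰ (1 : FractionRing D))) = I.1
    rw [FractionalIdeal.spanSingleton_one, mul_one, I.2.2]
  inv_mul_cancel I := by
    apply Subtype.ext
    change 1 / (1 / (1 / I.1 * I.1)) = FractionalIdeal.spanSingleton D⁰ (1 : FractionRing D)
    rw [FractionalIdeal.spanSingleton_one, mul_comm, IsKrullDomain.one_div_mul_one_div I.2.1,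
      FractionalIdeal.div_one]
  mul_comm I J := by
    apply Subtype.ext
    change 1 / (1 / (I.1 * J.1)) = 1 / (1 / (J.1 * I.1))
    rw [mul_comm]

/-- The group homomorphism sending `x` to the principal divisorial ideal `xD`. -/
noncomputable def principalHom (D : Type*) [CommRing D] [IsDomain D] [IsKrullDomain D] :
    (FractionRing D)ˣ →* DivisorialIdeal D where
  toFun := principal
  map_one' := rfl
  map_mul' x y := by
    apply Subtype.ext
    change FractionalIdeal.spanSingleton D⁰ ((x * y : (FractionRing D)ˣ) : FractionRing D) =
      1 / (1 / (FractionalIdeal.spanSingleton D⁰ (x : FractionRing D) *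
        FractionalIdeal.spanSingleton D⁰ (y : FractionRing D)))
    rw [FractionalIdeal.spanSingleton_mul_spanSingleton, ← Units.val_mul,
      (isDivisorial_spanSingleton (x * y).ne_zero).2]

end DivisorialIdeal

/-- The divisor class group `Cl(D)` of a Krull domain `D`: divisorial fractional ideals modulo
principal fractional ideals. -/
abbrev DivisorClassGroup (D : Type*) [CommRing D] [IsDomain D] [IsKrullDomain D] : Type _ :=
  DivisorialIdeal D ⧸ (DivisorialIdeal.principalHom D).range

/-- The class of a divisorial fractional ideal in the divisor class group. -/
noncomputable def divisorClass {D : Type*} [CommRing D] [IsDomain D] [IsKrullDomain D]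
    (I : DivisorialIdeal D) : DivisorClassGroup D :=
  QuotientGroup.mk I

/-- An integral ideal that is divisorial, as an element of the set of divisorial ideals. -/
def DivisorialIdeal.ofIdeal {D : Type*} [CommRing D] [IsDomain D] (a : Ideal D)
    (ha : IsDivisorial (a : FractionalIdeal D⁰ (FractionRing D))) : DivisorialIdeal D :=
  ⟨a, ha⟩

/-- `SameDivisorClass a b`, written `a ≡ b` in the literature: `a` and `b` are divisorial ideals
of `D` that represent the same class in the divisor class group `Cl(D)`. -/
def SameDivisorClass {D : Type*} [CommRing D] [IsDomain D] [IsKrullDomain D] (a b : Ideal D) :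
    Prop :=
  ∃ (ha : IsDivisorial (a : FractionalIdeal D⁰ (FractionRing D)))
    (hb : IsDivisorial (b : FractionalIdeal D⁰ (FractionRing D))),
    divisorClass (.ofIdeal a ha) = divisorClass (.ofIdeal b hb)

/-!
The divisor of a non-zero `a`, the multiset of height-one primes counted with their valuations
at `a`, is additive and detects divisibility (`divisor_mul`, `dvd_iff_divisor_le`), so everything
below is a statement about principal effective divisors. The hypothesis on `D` says that for each
height-one prime `P` there is a height-one prime `Q` with `P + Q` principal
(`exists_divisor_eq_pair`).

In an HFD this forces every atom to have degree at most two (`Irreducible.card_divisor_le_two`).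
Let `div a = P₁ + ⋯ + Pₘ` with `a` an atom and `m ≥ 2`, and let `Pᵢ + Qᵢ = div bᵢ`. No `Pᵢ` is
principal, hence no `Qᵢ` is, and each `bᵢ` is an atom. Write `b₁ ⋯ bₘ = a * c`. Half-factoriality
makes `c` a product of `m - 1` atoms; each of them has degree at least two, because `div c` is the
sum of the non-principal `Qᵢ`. So `2 * (m - 1) ≤ m`.

Now let `p`, `q` be non-associate atoms dividing `z`. If their divisors are disjoint, then `p * q`
divides `z` and one takes `p' = q`, `q' = p`. Otherwise `div p = G + P` and `div q = G + Q` with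
`P ≠ Q`, and with `z = p * w` the prime `Q` occurs in `div w`, hence in the divisor of some atom
`p'` of a factorization of `w`. Then `q` divides `p * p'`, and comparing lengths shows that the
cofactor `q'` is an atom.
-/

/-! ### Divisors on a Krull domain -/

/-- The height-one primes of `D`, the index set of the divisors on `D`. -/
def HeightOnePrime (D : Type*) [CommRing D] : Type _ :=
  {p : Ideal D // p.IsPrime ∧ p.height = 1}

namespace HeightOnePrime

variable {D : Type*} [CommRing D]

instance (P : HeightOnePrime D) : P.1.IsPrime := P.2.1

theorem exists_mem_notMem {P Q : HeightOnePrime D} (h : P ≠ Q) : ∃ t ∈ P.1, t ∉ Q.1 := by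
  by_contra! hle
  have hlt : P.1 < Q.1 := lt_of_le_of_ne hle fun e => h (Subtype.ext e)
  have : Q.1.FiniteHeight := ⟨Or.inr (by rw [Q.2.2]; exact ENat.one_ne_top)⟩
  have := Ideal.height_strict_mono_of_isPrime_of_isPrime hlt
  rw [P.2.2, Q.2.2] at this
  exact lt_irrefl _ this

theorem sq_mem_symbolicPower (P : HeightOnePrime D) {t : D} (ht : t ∈ P.1) :
    t ^ 2 ∈ symbolicPower P.1 2 :=
  Ideal.mem_map_of_mem _ (Ideal.pow_mem_pow ht 2)

variable [IsDomain D]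

theorem algebraMap_injective (P : HeightOnePrime D) :
    Function.Injective (algebraMap D (Localization.AtPrime P.1)) :=
  IsLocalization.injective _ P.1.primeCompl_le_nonZeroDivisors

variable [IsKrullDomain D]

instance (P : HeightOnePrime D) : IsDiscreteValuationRing (Localization.AtPrime P.1) :=
  IsKrullDomain.isDiscreteValuationRing P.1 P.2.2

/-- The discrete valuation of `a` at the height-one prime `P`, as a natural number
(with the junk value `0` at `a = 0`). -/
noncomputable def ord (P : HeightOnePrime D) (a : D) : ℕ :=
  (IsDiscreteValuationRing.addVal (Localization.AtPrime P.1)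
    (algebraMap D (Localization.AtPrime P.1) a)).toNat

theorem coe_ord (P : HeightOnePrime D) {a : D} (ha : a ≠ 0) :
    (P.ord a : ℕ∞) = IsDiscreteValuationRing.addVal (Localization.AtPrime P.1)
      (algebraMap D (Localization.AtPrime P.1) a) := by
  refine ENat.natCast_toNat fun h => ha (P.algebraMap_injective ?_)
  rw [map_zero]
  exact IsDiscreteValuationRing.addVal_eq_top_iff.mp h

theorem ord_mul (P : HeightOnePrime D) {a b : D} (ha : a ≠ 0) (hb : b ≠ 0) :
    P.ord (a * b) = P.ord a + P.ord b := by
  have : ((P.ord (a * b) : ℕ) : ℕ∞) = P.ord a + P.ord b := by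
    rw [coe_ord P ha, coe_ord P hb, coe_ord P (mul_ne_zero ha hb), map_mul,
      IsDiscreteValuationRing.addVal_mul]
  exact_mod_cast this

theorem ord_eq_zero_iff (P : HeightOnePrime D) {a : D} (ha : a ≠ 0) :
    P.ord a = 0 ↔ a ∉ P.1 := by
  have : P.ord a = 0 ↔ (P.ord a : ℕ∞) = 0 := by norm_cast
  rw [this, coe_ord P ha, IsDiscreteValuationRing.addVal_eq_zero_iff,
    IsLocalization.AtPrime.isUnit_to_map_iff (Localization.AtPrime P.1) P.1]
  rfl

theorem one_le_ord (P : HeightOnePrime D) {a : D} (ha : a ≠ 0) (h : a ∈ P.1) : 1 ≤ P.ord a :=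
  Nat.one_le_iff_ne_zero.mpr fun h0 => (P.ord_eq_zero_iff ha).mp h0 h

theorem ord_le_of_dvd (P : HeightOnePrime D) {a b : D} (hb : b ≠ 0) (h : a ∣ b) :
    P.ord a ≤ P.ord b := by
  obtain ⟨c, rfl⟩ := h
  rw [P.ord_mul (left_ne_zero_of_mul hb) (right_ne_zero_of_mul hb)]
  exact Nat.le_add_right _ _

theorem exists_ord_eq_one (P : HeightOnePrime D) : ∃ t ∈ P.1, t ≠ 0 ∧ P.ord t = 1 := by
  obtain ⟨ϖ, hϖ⟩ := IsDiscreteValuationRing.exists_irreducible (Localization.AtPrime P.1)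
  obtain ⟨t, s, rfl⟩ := IsLocalization.exists_mk'_eq P.1.primeCompl ϖ
  have hs := IsLocalization.map_units (Localization.AtPrime P.1) s
  have ht : Irreducible (algebraMap D (Localization.AtPrime P.1) t) := by
    rw [← IsLocalization.mk'_spec (Localization.AtPrime P.1) t s]
    exact (irreducible_mul_isUnit hs).mpr hϖ
  have ht0 : t ≠ 0 := by
    rintro rfl
    exact ht.ne_zero (map_zero _)
  have h1 : P.ord t = 1 := by
    have : (P.ord t : ℕ∞) = 1 := by
      rw [coe_ord P ht0, IsDiscreteValuationRing.addVal_uniformizer ht]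
    exact_mod_cast this
  refine ⟨t, ?_, ht0, h1⟩
  by_contra hn
  rw [(P.ord_eq_zero_iff ht0).mpr hn] at h1
  exact zero_ne_one h1

theorem two_le_ord_of_mem_symbolicPower (P : HeightOnePrime D) {x : D} (hx : x ≠ 0)
    (h : x ∈ symbolicPower P.1 2) : 2 ≤ P.ord x := by
  obtain ⟨ϖ, hϖ⟩ := IsDiscreteValuationRing.exists_irreducible (Localization.AtPrime P.1)
  have h' : algebraMap D (Localization.AtPrime P.1) x ∈
      (P.1 ^ 2).map (algebraMap D (Localization.AtPrime P.1)) := h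
  rw [Ideal.map_pow, Localization.AtPrime.map_eq_maximalIdeal, hϖ.maximalIdeal_eq,
    Ideal.span_singleton_pow, Ideal.mem_span_singleton,
    ← IsDiscreteValuationRing.addVal_le_iff_dvd, ← coe_ord P hx, hϖ.addVal_pow] at h'
  exact_mod_cast h'

end HeightOnePrime

section Divisor

variable {D : Type*} [CommRing D] [IsDomain D] [IsKrullDomain D]

theorem finite_support_ord {a : D} (ha : a ≠ 0) :
    (Function.support fun P : HeightOnePrime D => P.ord a).Finite := by
  refine Set.Finite.of_finite_image (f := Subtype.val)
    ((IsKrullDomain.finite_height_one a ha).subset ?_) Subtype.val_injective.injOn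
  rintro _ ⟨P, hP, rfl⟩
  refine ⟨P.2.1, P.2.2, ?_⟩
  by_contra hn
  exact hP ((P.ord_eq_zero_iff ha).mpr hn)

open Classical in
/-- The divisor of `a`: the multiset of height-one primes in which `P` occurs `P.ord a` times
(with the junk value `0` at `a = 0`). -/
noncomputable def divisor (a : D) : Multiset (HeightOnePrime D) :=
  if ha : a = 0 then 0 else
    Finsupp.toMultiset (Finsupp.ofSupportFinite (fun P : HeightOnePrime D => P.ord a)
      (finite_support_ord ha))

open Classical in
theorem count_divisor {a : D} (ha : a ≠ 0) (P : HeightOnePrime D) :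
    (divisor a).count P = P.ord a := by
  rw [divisor, dif_neg ha, Finsupp.count_toMultiset]
  rfl

theorem divisor_mul {a b : D} (ha : a ≠ 0) (hb : b ≠ 0) :
    divisor (a * b) = divisor a + divisor b := by
  classical
  ext P
  rw [Multiset.count_add, count_divisor ha, count_divisor hb, count_divisor (mul_ne_zero ha hb),
    P.ord_mul ha hb]

/-- Divisibility is read off from divisors, because `D` is the intersection of its localizations
at height-one primes. -/
theorem dvd_iff_divisor_le {a b : D} (ha : a ≠ 0) (hb : b ≠ 0) :
    a ∣ b ↔ divisor a ≤ divisor b := by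
  classical
  constructor
  · rintro ⟨c, rfl⟩
    rw [divisor_mul ha (right_ne_zero_of_mul hb)]
    exact Multiset.le_add_right _ _
  intro h
  have hinj := IsFractionRing.injective D (FractionRing D)
  have ha1 : algebraMap D (FractionRing D) a ≠ 0 := by simpa using ha
  have key : ∀ P : HeightOnePrime D, ∃ u s : D, s ∉ P.1 ∧
      algebraMap D (FractionRing D) b / algebraMap D (FractionRing D) a =
        algebraMap D (FractionRing D) u / algebraMap D (FractionRing D) s := by
    intro P
    have hP : (P.ord a : ℕ∞) ≤ P.ord b := by
      have := Multiset.le_iff_count.mp h P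
      rw [count_divisor ha, count_divisor hb] at this
      exact_mod_cast this
    rw [P.coe_ord ha, P.coe_ord hb, IsDiscreteValuationRing.addVal_le_iff_dvd] at hP
    obtain ⟨t, ht⟩ := hP
    obtain ⟨u, s, rfl⟩ := IsLocalization.exists_mk'_eq P.1.primeCompl t
    refine ⟨u, s, s.2, ?_⟩
    have hs0 : (s : D) ≠ 0 := fun h0 => s.2 (h0 ▸ P.1.zero_mem)
    have hs1 : algebraMap D (FractionRing D) s ≠ 0 := by simpa using hs0
    have e : b * s = a * u := by
      apply P.algebraMap_injective
      rw [map_mul, ht, mul_assoc, IsLocalization.mk'_spec, ← map_mul]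
    rw [div_eq_div_iff ha1 hs1, ← map_mul, e, map_mul, mul_comm]
  obtain ⟨c, hc⟩ := IsKrullDomain.mem_of_forall_height_one
    (algebraMap D (FractionRing D) b / algebraMap D (FractionRing D) a)
    fun p hp hp1 => key ⟨p, hp, hp1⟩
  refine ⟨c, hinj ?_⟩
  rw [map_mul, ← hc, mul_div_cancel₀ _ ha1]

theorem divisor_one : divisor (1 : D) = 0 := by
  have := divisor_mul (D := D) one_ne_zero one_ne_zero
  rw [mul_one] at this
  exact left_eq_add.mp this

theorem isUnit_iff_divisor_eq_zero {a : D} (ha : a ≠ 0) : IsUnit a ↔ divisor a = 0 := by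
  rw [isUnit_iff_dvd_one, dvd_iff_divisor_le ha one_ne_zero, divisor_one, Multiset.le_zero]

theorem associated_of_divisor_eq {a b : D} (ha : a ≠ 0) (hb : b ≠ 0)
    (h : divisor a = divisor b) : Associated a b :=
  associated_of_dvd_dvd ((dvd_iff_divisor_le ha hb).mpr h.le) ((dvd_iff_divisor_le hb ha).mpr h.ge)

/-! ### Ideals in the trivial divisor class -/

theorem SameDivisorClass.exists_eq_span {a : Ideal D} (h : SameDivisorClass a ⊤) :
    ∃ x : D, x ≠ 0 ∧ a = Ideal.span {x} := by
  obtain ⟨ha, hb, h⟩ := h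
  have htop : DivisorialIdeal.ofIdeal (⊤ : Ideal D) hb = 1 := by
    apply Subtype.ext
    change ((⊤ : Ideal D) : FractionalIdeal D⁰ (FractionRing D)) =
      FractionalIdeal.spanSingleton D⁰ (1 : FractionRing D)
    rw [FractionalIdeal.coeIdeal_top, FractionalIdeal.spanSingleton_one]
  rw [htop] at h
  obtain ⟨u, hu⟩ := (QuotientGroup.eq_one_iff _).mp h
  have hu' : FractionalIdeal.spanSingleton D⁰ (u : FractionRing D) =
      (a : FractionalIdeal D⁰ (FractionRing D)) := congrArg Subtype.val hu
  have hmem : (u : FractionRing D) ∈ (a : FractionalIdeal D⁰ (FractionRing D)) :=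
    hu' ▸ FractionalIdeal.mem_spanSingleton_self _ _
  obtain ⟨x, -, hx⟩ := (FractionalIdeal.mem_coeIdeal _).mp hmem
  refine ⟨x, ?_, FractionalIdeal.coeIdeal_injective (K := FractionRing D) ?_⟩
  · rintro rfl
    exact u.ne_zero (by rw [← hx, map_zero])
  · change (a : FractionalIdeal D⁰ (FractionRing D)) =
      (Ideal.span {x} : Ideal D)
    rw [FractionalIdeal.coeIdeal_span_singleton, hx, hu']

open HeightOnePrime in
/-- Each alternative of the hypothesis on `P` makes `P + Q` a principal divisor for some `Q`
(with `Q = P` in the first one). -/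
theorem exists_divisor_eq_pair (P : HeightOnePrime D)
    (h : SameDivisorClass (symbolicPower P.1 2) ⊤ ∨
      ∃ q : Ideal D, q.IsPrime ∧ q.height = 1 ∧ SameDivisorClass (P.1 ⊓ q) ⊤) :
    ∃ (Q : HeightOnePrime D) (b : D), b ≠ 0 ∧ divisor b = {P, Q} := by
  classical
  obtain ⟨t, htP, ht0, ht1⟩ := P.exists_ord_eq_one
  rcases h with h | ⟨q, hq, hq1, h⟩
  · obtain ⟨x, hx0, hx⟩ := h.exists_eq_span
    have hdvd : ∀ y ∈ P.1, x ∣ y ^ 2 := fun y hy => by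
      rw [← Ideal.mem_span_singleton, ← hx]
      exact P.sq_mem_symbolicPower hy
    refine ⟨P, x, hx0, ?_⟩
    ext R
    rw [count_divisor hx0]
    by_cases hR : R = P
    · subst hR
      have h1 := R.two_le_ord_of_mem_symbolicPower hx0
        (hx ▸ Ideal.mem_span_singleton_self x)
      have h2 := R.ord_le_of_dvd (pow_ne_zero 2 ht0) (hdvd t htP)
      rw [pow_two, R.ord_mul ht0 ht0, ht1] at h2
      simp
      omega
    · obtain ⟨y, hyP, hyR⟩ := exists_mem_notMem (Ne.symm hR)
      rw [(R.ord_eq_zero_iff hx0).mpr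
        fun hxR => hyR (R.2.1.mem_of_pow_mem 2 (R.1.mem_of_dvd (hdvd y hyP) hxR))]
      simp [hR]
  · let Q : HeightOnePrime D := ⟨q, hq, hq1⟩
    obtain ⟨x, hx0, hx⟩ := h.exists_eq_span
    have hxmem : x ∈ P.1 ⊓ q := hx ▸ Ideal.mem_span_singleton_self x
    have hdvd : ∀ y ∈ P.1 ⊓ q, x ∣ y := fun y hy => by
      rwa [← Ideal.mem_span_singleton, ← hx]
    have hother : ∀ R : HeightOnePrime D, R ≠ P → R ≠ Q → R.ord x = 0 := by
      intro R hRP hRQ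
      obtain ⟨y, hyP, hyR⟩ := exists_mem_notMem (Ne.symm hRP)
      obtain ⟨z, hzQ, hzR⟩ := exists_mem_notMem (Ne.symm hRQ)
      refine (R.ord_eq_zero_iff hx0).mpr fun hxR => ?_
      have := R.1.mem_of_dvd (hdvd (y * z) ⟨P.1.mul_mem_right _ hyP, q.mul_mem_left _ hzQ⟩) hxR
      exact (R.2.1.mem_or_mem this).elim hyR hzR
    by_cases hPQ : P = Q
    · -- Here `P` itself is principal, and the square of its generator has divisor `P + P`.
      have hqP : q = P.1 := congrArg Subtype.val hPQ.symm
      have h1 : P.ord x = 1 := by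
        refine le_antisymm ?_ (P.one_le_ord hx0 hxmem.1)
        exact ht1 ▸ P.ord_le_of_dvd ht0 (hdvd t ⟨htP, hqP ▸ htP⟩)
      refine ⟨P, x * x, mul_ne_zero hx0 hx0, ?_⟩
      ext R
      rw [count_divisor (mul_ne_zero hx0 hx0), R.ord_mul hx0 hx0]
      by_cases hR : R = P
      · subst hR
        simp [h1]
      · rw [hother R hR (hPQ ▸ hR)]
        simp [hR]
    · have hone : ∀ A B : HeightOnePrime D, A ≠ B → A.1 ⊓ B.1 = P.1 ⊓ q → A.ord x = 1 := by
        intro A B hAB hinf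
        obtain ⟨y, hyA, hy0, hy1⟩ := A.exists_ord_eq_one
        obtain ⟨z, hzB, hzA⟩ := exists_mem_notMem (Ne.symm hAB)
        have hz0 : z ≠ 0 := fun h0 => hzA (h0 ▸ A.1.zero_mem)
        refine le_antisymm ?_ (A.one_le_ord hx0 (hinf ▸ hxmem : x ∈ A.1 ⊓ B.1).1)
        have := A.ord_le_of_dvd (mul_ne_zero hy0 hz0) (hdvd (y * z)
          (hinf ▸ ⟨A.1.mul_mem_right _ hyA, B.1.mul_mem_left _ hzB⟩))
        rwa [A.ord_mul hy0 hz0, hy1, (A.ord_eq_zero_iff hz0).mpr hzA] at this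
      refine ⟨Q, x, hx0, ?_⟩
      ext R
      rw [count_divisor hx0]
      by_cases hRP : R = P
      · subst hRP
        rw [hone R Q hPQ rfl]
        simp [hPQ]
      · by_cases hRQ : R = Q
        · subst hRQ
          rw [hone Q P (Ne.symm hPQ) (inf_comm _ _)]
          simp [Ne.symm hPQ, Multiset.insert_eq_cons]
        · rw [hother R hRP hRQ]
          simp [Multiset.insert_eq_cons, hRP, hRQ]

end Divisor

/-! ### Divisors of atoms -/

section Atoms

variable {D : Type*} [CommRing D] [IsDomain D]

theorem prod_ne_zero_of_irreducible {t : Multiset D} (ht : ∀ b ∈ t, Irreducible b) :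
    t.prod ≠ 0 :=
  Multiset.prod_ne_zero fun h0 => (ht 0 h0).ne_zero rfl

variable [IsKrullDomain D]

theorem Irreducible.divisor_ne_zero {a : D} (ha : Irreducible a) : divisor a ≠ 0 := fun h =>
  ha.not_isUnit ((isUnit_iff_divisor_eq_zero ha.ne_zero).mpr h)

theorem Irreducible.divisor_eq_of_le {a x : D} (ha : Irreducible a) (hx : x ≠ 0)
    (hx1 : divisor x ≠ 0) (h : divisor x ≤ divisor a) : divisor a = divisor x := by
  obtain ⟨c, rfl⟩ := (dvd_iff_divisor_le hx ha.ne_zero).mpr h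
  have hc : c ≠ 0 := right_ne_zero_of_mul ha.ne_zero
  have hcu : IsUnit c := (ha.isUnit_or_isUnit rfl).resolve_left fun hu =>
    hx1 ((isUnit_iff_divisor_eq_zero hx).mp hu)
  rw [divisor_mul hx hc, (isUnit_iff_divisor_eq_zero hc).mp hcu, add_zero]

/-- No prime in the divisor of an atom of degree at least two is principal. -/
theorem Irreducible.divisor_ne_singleton {a x : D} {P : HeightOnePrime D} (ha : Irreducible a)
    (h2 : 2 ≤ (divisor a).card) (hP : P ∈ divisor a) (hx : x ≠ 0) : divisor x ≠ {P} := by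
  intro h
  have := ha.divisor_eq_of_le hx (by simp [h]) (by rwa [h, Multiset.singleton_le])
  rw [this, h, Multiset.card_singleton] at h2
  omega

theorem Irreducible.irreducible_of_divisor_eq_pair {a b : D} {P Q : HeightOnePrime D}
    (ha : Irreducible a) (h2 : 2 ≤ (divisor a).card) (hP : P ∈ divisor a) (hb : b ≠ 0)
    (hdiv : divisor b = {P, Q}) : Irreducible b := by
  refine ⟨fun hu => ?_, fun x y hxy => ?_⟩
  · have := (isUnit_iff_divisor_eq_zero hb).mp hu
    simp [hdiv] at this
  subst hxy
  have hx := left_ne_zero_of_mul hb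
  have hy := right_ne_zero_of_mul hb
  rw [isUnit_iff_divisor_eq_zero hx, isUnit_iff_divisor_eq_zero hy]
  rw [divisor_mul hx hy] at hdiv
  by_contra! hne
  have hcx := Multiset.card_pos.mpr hne.1
  have hcy := Multiset.card_pos.mpr hne.2
  have hcard := congrArg Multiset.card hdiv
  rw [Multiset.card_add, Multiset.card_pair] at hcard
  have hsingle : ∀ z : D, z ≠ 0 → (divisor z).card = 1 → P ∉ divisor z := by
    intro z hz hz1 hPz
    obtain ⟨R, hR⟩ := Multiset.card_eq_one.mp hz1
    rw [hR, Multiset.mem_singleton] at hPz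
    exact ha.divisor_ne_singleton h2 hP hz (hPz ▸ hR)
  have hPmem : P ∈ divisor x + divisor y := by simp [hdiv]
  rcases Multiset.mem_add.mp hPmem with h | h
  · exact hsingle x hx (by omega) h
  · exact hsingle y hy (by omega) h

theorem mul_card_le_card_divisor_prod {k : ℕ} {u : Multiset D} (hu : ∀ d ∈ u, Irreducible d)
    (hk : ∀ d ∈ u, k ≤ (divisor d).card) : k * u.card ≤ (divisor u.prod).card := by
  induction u using Multiset.induction with
  | empty => simp
  | cons d u ih =>
    have hu' := fun e he => hu e (Multiset.mem_cons_of_mem he)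
    have h1 := ih hu' fun e he => hk e (Multiset.mem_cons_of_mem he)
    have h2 := hk d (Multiset.mem_cons_self d u)
    rw [Multiset.prod_cons, divisor_mul (hu d (Multiset.mem_cons_self d u)).ne_zero
      (prod_ne_zero_of_irreducible hu'), Multiset.card_add, Multiset.card_cons, mul_add]
    omega

theorem exists_mem_divisor_of_mem_divisor_prod {u : Multiset D} (hu : ∀ d ∈ u, Irreducible d)
    {P : HeightOnePrime D} (hP : P ∈ divisor u.prod) : ∃ d ∈ u, P ∈ divisor d := by
  induction u using Multiset.induction with
  | empty => simp [divisor_one] at hP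
  | cons d u ih =>
    have hu' := fun e he => hu e (Multiset.mem_cons_of_mem he)
    rw [Multiset.prod_cons, divisor_mul (hu d (Multiset.mem_cons_self d u)).ne_zero
      (prod_ne_zero_of_irreducible hu'), Multiset.mem_add] at hP
    rcases hP with hP | hP
    · exact ⟨d, Multiset.mem_cons_self d u, hP⟩
    · obtain ⟨e, he, hPe⟩ := ih hu' hP
      exact ⟨e, Multiset.mem_cons_of_mem he, hPe⟩

/-- Pairing each prime of `s` with a prime of the opposite class yields a product of `s.card` atoms
whose divisor is `s` plus a divisor of the same degree without principal primes. -/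
theorem Irreducible.exists_prod_divisor_eq_add {a : D} (ha : Irreducible a)
    (hpair : ∀ P : HeightOnePrime D, ∃ (Q : HeightOnePrime D) (b : D),
      b ≠ 0 ∧ divisor b = {P, Q})
    (h2 : 2 ≤ (divisor a).card) (s : Multiset (HeightOnePrime D))
    (hs : ∀ P ∈ s, P ∈ divisor a) :
    ∃ (t : Multiset D) (s' : Multiset (HeightOnePrime D)), (∀ b ∈ t, Irreducible b) ∧
      t.card = s.card ∧ s'.card = s.card ∧ divisor t.prod = s + s' ∧
      ∀ Q ∈ s', ∀ x : D, x ≠ 0 → divisor x ≠ {Q} := by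
  induction s using Multiset.induction with
  | empty => exact ⟨0, 0, by simp, rfl, rfl, by simp [divisor_one], by simp⟩
  | cons P s ih =>
    obtain ⟨t, s', ht, htc, hsc, hdiv, hnp⟩ := ih fun R hR => hs R (Multiset.mem_cons_of_mem hR)
    have hP := hs P (Multiset.mem_cons_self P s)
    obtain ⟨Q, b, hb, hbdiv⟩ := hpair P
    refine ⟨b ::ₘ t, Q ::ₘ s', ?_, by simp [htc], by simp [hsc], ?_, ?_⟩
    · intro c hc
      rcases Multiset.mem_cons.mp hc with rfl | hc
      · exact ha.irreducible_of_divisor_eq_pair h2 hP hb hbdiv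
      · exact ht c hc
    · rw [Multiset.prod_cons, divisor_mul hb (prod_ne_zero_of_irreducible ht), hbdiv, hdiv,
        Multiset.insert_eq_cons, ← Multiset.singleton_add P, ← Multiset.singleton_add P,
        ← Multiset.singleton_add Q]
      abel
    · intro R hR x hx hxR
      rcases Multiset.mem_cons.mp hR with rfl | hR
      · -- If `R` were principal, dividing `b` by its generator would make `P` principal.
        obtain ⟨y, rfl⟩ := (dvd_iff_divisor_le hx hb).mpr (by simp [hxR, hbdiv])
        have hy := right_ne_zero_of_mul hb
        refine ha.divisor_ne_singleton h2 hP hy ?_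
        rw [divisor_mul hx hy, hxR, Multiset.insert_eq_cons, ← Multiset.singleton_add P]
          at hbdiv
        exact add_left_cancel (hbdiv.trans (add_comm _ _))
      · exact hnp R hR x hx hxR

/-- Pairing an atom of degree `m ≥ 2` with opposite primes gives an element with a factorization
of length `m`. Its cofactor has degree `m` and, by half-factoriality, `m - 1` atoms of degree at
least two, so `m ≤ 2`. -/
theorem Irreducible.card_divisor_le_two (hHFD : IsHFD D)
    (hpair : ∀ P : HeightOnePrime D, ∃ (Q : HeightOnePrime D) (b : D),
      b ≠ 0 ∧ divisor b = {P, Q})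
    {a : D} (ha : Irreducible a) : (divisor a).card ≤ 2 := by
  by_contra! h3
  obtain ⟨t, s', ht, htc, hsc, hdiv, hnp⟩ :=
    ha.exists_prod_divisor_eq_add hpair h3.le (divisor a) fun _ h => h
  have ht0 := prod_ne_zero_of_irreducible ht
  obtain ⟨c, hc⟩ := (dvd_iff_divisor_le ha.ne_zero ht0).mpr
    (hdiv ▸ Multiset.le_add_right _ _)
  have hc0 : c ≠ 0 := right_ne_zero_of_mul (hc ▸ ht0)
  have hcdiv : divisor c = s' := by
    rw [hc, divisor_mul ha.ne_zero hc0] at hdiv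
    exact add_left_cancel hdiv
  have hcu : ¬ IsUnit c := by
    rw [isUnit_iff_divisor_eq_zero hc0, hcdiv, ← Multiset.card_eq_zero]
    omega
  obtain ⟨u, hu, rfl⟩ := hHFD.1 c hc0 hcu
  have hlen := hHFD.2 t (a ::ₘ u) ht
    (fun d hd => (Multiset.mem_cons.mp hd).elim (fun e => e ▸ ha) (hu d))
    (by rw [hc, Multiset.prod_cons])
  have hdeg := mul_card_le_card_divisor_prod (k := 2) hu fun d hd => by
    by_contra! hlt
    have hpos := Multiset.card_pos.mpr (hu d hd).divisor_ne_zero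
    obtain ⟨Q, hQ⟩ := Multiset.card_eq_one.mp (show (divisor d).card = 1 by omega)
    have hle := (dvd_iff_divisor_le (hu d hd).ne_zero hc0).mp (Multiset.dvd_prod hd)
    rw [hQ, Multiset.singleton_le, hcdiv] at hle
    exact hnp Q hle d (hu d hd).ne_zero hQ
  rw [hcdiv] at hdeg
  rw [Multiset.card_cons] at hlen
  omega

theorem Irreducible.exists_divisor_eq_pair (hHFD : IsHFD D)
    (hpair : ∀ P : HeightOnePrime D, ∃ (Q : HeightOnePrime D) (b : D),
      b ≠ 0 ∧ divisor b = {P, Q})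
    {a : D} (ha : Irreducible a) {P : HeightOnePrime D} (hP : P ∈ divisor a)
    (hne : divisor a ≠ {P}) : ∃ Q, divisor a = {P, Q} := by
  obtain ⟨s, hs⟩ := Multiset.exists_cons_of_mem hP
  have h2 := ha.card_divisor_le_two hHFD hpair
  have h0 : s ≠ 0 := by
    rintro rfl
    exact hne hs
  have h1 := Multiset.card_pos.mpr h0
  rw [hs, Multiset.card_cons] at h2
  obtain ⟨Q, rfl⟩ := Multiset.card_eq_one.mp (show s.card = 1 by omega)
  exact ⟨Q, hs⟩

end Atoms

/-! ### The irreducible divisor pair property -/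

theorem theorem3p4 (D : Type*) [CommRing D] [IsDomain D] [IsKrullDomain D]
    (hD : ∀ (p : Ideal D) [p.IsPrime], p.height = 1 →
      SameDivisorClass (symbolicPower p 2) ⊤ ∨
        ∃ q : Ideal D, q.IsPrime ∧ q.height = 1 ∧ SameDivisorClass (p ⊓ q) ⊤)
    (hHFD : IsHFD D) : IsIDPD D := by
  classical
  have hpair : ∀ P : HeightOnePrime D, ∃ (Q : HeightOnePrime D) (b : D),
      b ≠ 0 ∧ divisor b = {P, Q} := fun P => exists_divisor_eq_pair P (hD P.1 P.2.2)
  refine ⟨hHFD.1, fun z hz _ p q hp hq hpz hqz hpq => ?_⟩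
  have hne : divisor p ≠ divisor q := fun h => hpq (associated_of_divisor_eq hp.ne_zero hq.ne_zero h)
  by_cases hdisj : Disjoint (divisor p) (divisor q)
  · refine ⟨q, p, hq, hp, by rw [mul_comm], ?_⟩
    rw [dvd_iff_divisor_le (mul_ne_zero hq.ne_zero hp.ne_zero) hz,
      divisor_mul hq.ne_zero hp.ne_zero, add_comm, Multiset.add_eq_union_iff_disjoint.mpr hdisj]
    exact Multiset.union_le ((dvd_iff_divisor_le hp.ne_zero hz).mp hpz)
      ((dvd_iff_divisor_le hq.ne_zero hz).mp hqz)
  obtain ⟨G, hGp, hGq⟩ : ∃ G, G ∈ divisor p ∧ G ∈ divisor q := by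
    simpa [Multiset.disjoint_left] using hdisj
  have hGp1 : divisor p ≠ {G} := fun h => hne
    (hq.divisor_eq_of_le hp.ne_zero hp.divisor_ne_zero (by rwa [h, Multiset.singleton_le])).symm
  have hGq1 : divisor q ≠ {G} := fun h => hne
    (hp.divisor_eq_of_le hq.ne_zero hq.divisor_ne_zero (by rwa [h, Multiset.singleton_le]))
  obtain ⟨P, hP⟩ := hp.exists_divisor_eq_pair hHFD hpair hGp hGp1
  obtain ⟨Q, hQ⟩ := hq.exists_divisor_eq_pair hHFD hpair hGq hGq1
  have hPQ : Q ≠ P := fun h => hne (by rw [hP, hQ, h])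
  obtain ⟨w, rfl⟩ := hpz
  have hw : w ≠ 0 := right_ne_zero_of_mul hz
  have hQw : Q ∈ divisor w := by
    have hle := (dvd_iff_divisor_le hq.ne_zero hz).mp hqz
    rw [divisor_mul hp.ne_zero hw, hP, hQ, Multiset.insert_eq_cons, Multiset.insert_eq_cons,
      Multiset.cons_add, Multiset.cons_le_cons_iff, Multiset.singleton_le, Multiset.mem_add,
      Multiset.mem_singleton] at hle
    exact hle.resolve_left hPQ
  have hwu : ¬ IsUnit w := fun hu => by
    simp [(isUnit_iff_divisor_eq_zero hw).mp hu] at hQw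
  obtain ⟨u, hu, rfl⟩ := hHFD.1 w hw hwu
  obtain ⟨c, hcu, hQc⟩ := exists_mem_divisor_of_mem_divisor_prod hu hQw
  have hc := hu c hcu
  -- With `div p = G + P`, `div q = G + Q` and `Q` in `div c`, the product `p * c` is divisible
  -- by `q`; half-factoriality makes the cofactor an atom.
  obtain ⟨q', hq'⟩ : q ∣ p * c := by
    rw [dvd_iff_divisor_le hq.ne_zero (mul_ne_zero hp.ne_zero hc.ne_zero),
      divisor_mul hp.ne_zero hc.ne_zero, hQ, Multiset.insert_eq_cons, ← Multiset.singleton_add]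
    exact add_le_add (Multiset.singleton_le.mpr hGp) (Multiset.singleton_le.mpr hQc)
  have hpc0 := mul_ne_zero hp.ne_zero hc.ne_zero
  have hq'0 : q' ≠ 0 := right_ne_zero_of_mul (hq' ▸ hpc0)
  have hq'irr : Irreducible q' := by
    have hq'u : ¬ IsUnit q' := by
      intro h
      have hpq : p ∣ q := (h.dvd_mul_right).mp (hq' ▸ dvd_mul_right p c)
      exact ‹¬ Associated p q› (hp.associated_of_dvd hq hpq)
    obtain ⟨v, hv, rfl⟩ := hHFD.1 q' hq'0 hq'u
    have hlen := hHFD.2 {p, c} (q ::ₘ v) (by simp [hp, hc])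
      (fun d hd => (Multiset.mem_cons.mp hd).elim (fun e => e ▸ hq) (hv d))
      (by simpa using hq')
    rw [Multiset.card_pair, Multiset.card_cons] at hlen
    obtain ⟨d, rfl⟩ := Multiset.card_eq_one.mp (show v.card = 1 by omega)
    simpa using hv
  exact ⟨c, q', hc, hq'irr, hq' ▸ Associated.refl _,
    hq' ▸ mul_dvd_mul_left p (Multiset.dvd_prod hcu)⟩
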